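/- Let $G=(V,E)$ be a finite undirected graph, where loops and parallel edges are allowed. Suppose that $G$ is bridgeless (deleting an edge never disconnects its two ends) and triangulated, i.e. chordal: every circuit of length at least $4$ has a chord, that is, there is an edge of $G$ joining two vertices of the circuit that are not consecutive on it. Then: (1) $G$ has a nowhere-zero $4$-flow; that is, there are an orientation of $G$ and a map $\phi:E\to\mathbb{Z}_4\setminus\{0\}$ such that for every vertex $v$ the sum of $\phi(e)$ over the arcs $e$ with head $v$ minus the sum of $\phi(e)$ over the arcs $e$ with tail $v$ is $0$ in $\mathbb{Z}_4$. (2) There is an orientation $D$ of $G$ for which the zero map is the only $0$-conformal dual $4$-flow; that is, for a map $\phi:E\to\mathbb{Z}_4$, the following two conditions hold together if and only if $\phi=0$: $\phi(e)\in\{0,3\}$ for every $e\in E$, and around every circuit of $G$ the signed sum of $\phi$ is $0$ in $\mathbb{Z}_4$. Here an arc of $D$ is counted with sign $+$ if it is traversed from tail to head and with sign $-$ otherwise, and loops and pairs of parallel edges are circuits of length $1$ and $2$. -/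

import Mathlib

namespace Graph

variable {α β : Type*}

/-- An orientation of a multigraph: a choice of tail and head for every edge. -/
structure Orientation (G : Graph α β) where
  tail : G.edgeSet → α
  head : G.edgeSet → α
  isLink : ∀ e : G.edgeSet, G.IsLink e (tail e) (head e)

/-- A circuit of length `n ≥ 1` of a multigraph, listed in cyclic order: `n` distinct vertices and
`n` distinct edges, the `i`-th edge joining the `i`-th vertex to the next one.
A loop is a circuit of length 1 and two parallel edges form a circuit of length 2. -/
structure Circuit (G : Graph α β) (n : ℕ) [NeZero n] where
  vert : ZMod n → α
  edge : ZMod n → G.edgeSet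
  vert_injective : Function.Injective vert
  edge_injective : Function.Injective edge
  isLink : ∀ i, G.IsLink (edge i) (vert i) (vert (i + 1))

/-- An edge is a bridge if deleting it disconnects its two ends. -/
def IsBridge (G : Graph α β) (e : β) : Prop :=
  e ∈ G.edgeSet ∧
    ∀ x y, G.IsLink e x y → ¬ Relation.ReflTransGen (G.deleteEdges {e}).Adj x y

def Bridgeless (G : Graph α β) : Prop := ∀ e, ¬ G.IsBridge e

/-- Every circuit of length at least 4 has a chord, that is, an edge joining two vertices of the
circuit that are not consecutive on it. -/
def IsChordal (G : Graph α β) : Prop :=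
  ∀ (n : ℕ) [NeZero n], 4 ≤ n → ∀ C : G.Circuit n,
    ∃ i j : ZMod n, i ≠ j ∧ j ≠ i + 1 ∧ i ≠ j + 1 ∧ G.Adj (C.vert i) (C.vert j)

/-- `φ` is a `p`-flow: at each vertex, inflow minus outflow vanishes in `ℤ/p`.
(The sums are over the arcs with head `v`, respectively tail `v`; the edge set will be finite.) -/
def Orientation.IsFlow {G : Graph α β} (D : G.Orientation) {p : ℕ}
    (φ : G.edgeSet → ZMod p) : Prop :=
  ∀ v ∈ G.vertexSet,
    (∑ᶠ e ∈ {e | D.head e = v}, φ e) - (∑ᶠ e ∈ {e | D.tail e = v}, φ e) = 0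

open Classical in
/-- The signed sum of `φ` around the circuit `C`: an arc counts positively if it is traversed from
tail to head and negatively otherwise. (A loop, being a circuit by itself, counts positively.) -/
noncomputable def Orientation.circuitSum {G : Graph α β} (D : G.Orientation) {p : ℕ}
    (φ : G.edgeSet → ZMod p) {n : ℕ} [NeZero n] (C : G.Circuit n) : ZMod p :=
  ∑ i : ZMod n, if D.tail (C.edge i) = C.vert i then φ (C.edge i) else -φ (C.edge i)

/-- `φ` is a dual `p`-flow: its signed sum around each circuit vanishes in `ℤ/p`. -/
def Orientation.IsDualFlow {G : Graph α β} (D : G.Orientation) {p : ℕ}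
    (φ : G.edgeSet → ZMod p) : Prop :=
  ∀ (n : ℕ) [NeZero n] (C : G.Circuit n), D.circuitSum φ C = 0

/-- `G` is `p`-flowing: some orientation of `G` admits a nowhere-zero `p`-flow. -/
def IsFlowing (G : Graph α β) (p : ℕ) : Prop :=
  ∃ (D : G.Orientation) (φ : G.edgeSet → ZMod p), D.IsFlow φ ∧ ∀ e, φ e ≠ 0

/-- `φ` is `ψ`-conformal: `φ(e) ∈ {ψ(e), p - 1}` for every edge `e`, where the label `p - 1` is
the residue class `-1`. -/
def IsConformal {G : Graph α β} {p : ℕ} (ψ φ : G.edgeSet → ZMod p) : Prop :=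
  ∀ e, φ e = ψ e ∨ φ e = -1

end Graph

/-! Both claims need only that every edge lies in a circuit of length less than 4. Join the ends of
`e` by a shortest path avoiding `e`; together with `e` it is a circuit whose chords would shorten
the path, so chordality bounds its length by 3 (`exists_short_circuit`). For the flow, add multiples
of such circuits one at a time: fewer than `p` edges exclude fewer than `p` multiples, so the new
circuit can be made nonzero throughout. For the orientation, direct the new edges of each circuit
along it. On the old edges a conformal dual flow already vanishes, so fewer than `p` values in `{0,
-1}` sum to zero, and all are 0. -/

/-- A walk of minimal length between two related points has distinct vertices and no shortcuts. -/
theorem exists_geodesic_of_reflTransGen {V : Type*} {r : V → V → Prop} {x y : V}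
    (h : Relation.ReflTransGen r x y) :
    ∃ (m : ℕ) (v : ℕ → V), v 0 = x ∧ v m = y ∧
      (∀ i < m, r (v i) (v (i + 1)) ∨ r (v (i + 1)) (v i)) ∧
      ∀ i j, i < j → j ≤ m → v i ≠ v j ∧ (i + 1 < j → ¬ r (v i) (v j)) := by
  let H := SimpleGraph.fromRel r
  have hreach : H.Reachable x y := by
    induction h with
    | refl => exact .refl _
    | @tail b c _ hbc ih =>
      by_cases hne : b = c
      · exact hne ▸ ih
      · exact ih.trans (SimpleGraph.Adj.reachable ⟨hne, Or.inl hbc⟩)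
  obtain ⟨w, hw⟩ := hreach.exists_walk_length_eq_dist
  refine ⟨w.length, w.getVert, w.getVert_zero, w.getVert_length,
    fun i hi => (w.adj_getVert_succ hi).2, fun i j hij hj => ?_⟩
  have hne : w.getVert i ≠ w.getVert j := fun heq => by
    have hle := SimpleGraph.dist_le ((w.take i).append ((w.drop j).copy heq.symm rfl))
    simp only [SimpleGraph.Walk.length_append, SimpleGraph.Walk.length_copy,
      SimpleGraph.Walk.take_length, SimpleGraph.Walk.drop_length] at hle
    omega
  refine ⟨hne, fun hij' hr => ?_⟩
  have hadj : H.Adj (w.getVert i) (w.getVert j) := ⟨hne, Or.inl hr⟩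
  have hle := SimpleGraph.dist_le ((w.take i).append (.cons hadj (w.drop j)))
  simp only [SimpleGraph.Walk.length_append, SimpleGraph.Walk.length_cons,
    SimpleGraph.Walk.take_length, SimpleGraph.Walk.drop_length] at hle
  omega

/-! ### Short circuits in bridgeless chordal graphs -/

namespace Graph

variable {α β : Type*} {G : Graph α β}

/-- A sequence of distinct vertices joined successively by edges other than `e`, where `e` joins
the last vertex to the first, closes up to a circuit. -/
theorem exists_circuit_of_path {m : ℕ} {v : ℕ → α} {e : G.edgeSet} (f : ℕ → G.edgeSet)
    (hne : ∀ i j, i < j → j ≤ m → v i ≠ v j)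
    (hf : ∀ i < m, G.IsLink (f i) (v i) (v (i + 1)) ∧ f i ≠ e)
    (he : G.IsLink e (v m) (v 0)) :
    ∃ C : G.Circuit (m + 1), (∀ i : Fin (m + 1), C.vert i = v i) ∧ ∃ i, C.edge i = e := by
  have hinj : ∀ i j, i ≤ m → j ≤ m → v i = v j → i = j := fun i j hi hj h => by
    rcases lt_trichotomy i j with hij | hij | hij
    · exact absurd h (hne i j hij hj)
    · exact hij
    · exact absurd h.symm (hne j i hij hi)
  -- `ZMod (m + 1)` unfolds to `Fin (m + 1)`, whose wraparound supplies the closing edge `e`.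
  let vert : Fin (m + 1) → α := fun i => v i
  let edge : Fin (m + 1) → G.edgeSet := fun i => if (i : ℕ) < m then f i else e
  have hvert : Function.Injective vert := fun i j h =>
    Fin.ext (hinj i j (by omega) (by omega) h)
  have hedge : Function.Injective edge := fun i j h => by
    simp only [edge] at h
    split_ifs at h with hi hj hj
    · have h1 := (hf i hi).1
      rw [h] at h1
      rcases h1.eq_and_eq_or_eq_and_eq (hf j hj).1 with ⟨h2, -⟩ | ⟨h2, h3⟩
      · exact Fin.ext (hinj i j (by omega) (by omega) h2)
      · have := hinj i (j + 1) (by omega) (by omega) h2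
        have := hinj (i + 1) j (by omega) (by omega) h3
        omega
    · exact absurd h (hf i hi).2
    · exact absurd h.symm (hf j hj).2
    · exact Fin.ext (by omega)
  have hlink : ∀ i, G.IsLink (edge i) (vert i) (vert (i + 1)) := fun i => by
    by_cases hi : (i : ℕ) < m
    · have h1 : ((i + 1 : Fin (m + 1)) : ℕ) = i + 1 := by
        rw [Fin.val_add_one_of_lt (Fin.lt_def.2 (by simpa using hi))]
      simpa only [edge, vert, if_pos hi, h1] using (hf i hi).1
    · have h0 : i = Fin.last m := Fin.ext (by simp; omega)
      subst h0
      simpa [edge, vert] using he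
  exact ⟨⟨vert, edge, hvert, hedge, hlink⟩, fun _ => rfl, Fin.last m, by simp [edge]⟩

/-- In a bridgeless chordal graph every edge lies in a circuit of length at most 3. -/
theorem exists_short_circuit (hbridge : G.Bridgeless) (hchordal : G.IsChordal) (e : G.edgeSet) :
    ∃ (n : ℕ) (_ : NeZero n) (C : G.Circuit n), n ≤ 3 ∧ ∃ i, C.edge i = e := by
  obtain ⟨x, y, hxy, hreach⟩ : ∃ x y, G.IsLink e x y ∧
      Relation.ReflTransGen (G.deleteEdges {e.1}).Adj x y := by
    have := hbridge e
    simp only [IsBridge, not_and, not_forall, not_not] at this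
    obtain ⟨x, y, h, h'⟩ := this e.2
    exact ⟨x, y, h, h'⟩
  obtain ⟨m, v, rfl, rfl, hadj, hgeo⟩ := exists_geodesic_of_reflTransGen hreach
  have hstep : ∀ i, ∃ f : G.edgeSet, i < m → G.IsLink f (v i) (v (i + 1)) ∧ f ≠ e := fun i => by
    by_cases hi : i < m
    · obtain ⟨f, hf⟩ : (G.deleteEdges {e.1}).Adj (v i) (v (i + 1)) :=
        (hadj i hi).elim id Adj.symm
      rw [deleteEdges_isLink] at hf
      exact ⟨⟨f, hf.1.edge_mem⟩, fun _ => ⟨hf.1, fun h => hf.2 (congrArg Subtype.val h)⟩⟩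
    · exact ⟨e, fun h => absurd h hi⟩
  choose f hf using hstep
  obtain ⟨C, hCv, hCe⟩ := exists_circuit_of_path f (fun i j hij hj => (hgeo i j hij hj).1) hf
    hxy.symm
  refine ⟨m + 1, inferInstance, C, ?_, hCe⟩
  by_contra! hm
  -- a chord would be a shortcut
  have key : ∀ i j : Fin (m + 1), i < j → j ≠ i + 1 → i ≠ j + 1 →
      ¬ G.Adj (C.vert i) (C.vert j) := fun i j hij h1 h2 ⟨g, hg⟩ => by
    rw [hCv, hCv] at hg
    have hij' : (i : ℕ) < j := hij
    have hj : (j : ℕ) ≤ m := by omega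
    have hi1 : ((i + 1 : Fin (m + 1)) : ℕ) = i + 1 :=
      Fin.val_add_one_of_lt (lt_of_lt_of_le hij (Fin.le_last j))
    have hlt : (i : ℕ) + 1 < j := by
      have : (j : ℕ) ≠ i + 1 := fun h => h1 (Fin.ext (by rw [hi1, h]))
      omega
    refine (hgeo i j hij' hj).2 hlt ⟨g, ?_⟩
    rw [deleteEdges_isLink]
    refine ⟨hg, fun hge => ?_⟩
    rw [Set.mem_singleton_iff] at hge
    rw [hge] at hg
    -- The edge `e` is no shortcut, but its ends are consecutive on the circuit, so it is no chord
    -- either.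
    have hends : v i = v 0 ∧ v j = v m ∨ v i = v m ∧ v j = v 0 := hg.eq_and_eq_or_eq_and_eq hxy
    rcases hends with ⟨h3, h4⟩ | ⟨-, h4⟩
    · have hi0 : (i : ℕ) = 0 := by
        by_contra h
        exact (hgeo 0 i (by omega) (by omega)).1 h3.symm
      have hjm : (j : ℕ) = m := by
        by_contra h
        exact (hgeo j m (by omega) le_rfl).1 h4
      have h5 : j = Fin.last m := Fin.ext hjm
      exact h2 (by rw [h5, Fin.last_add_one]; exact Fin.ext hi0)
    · exact (hgeo 0 j (by omega) hj).1 h4.symm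
  obtain ⟨i, j, hij, h1, h2, h⟩ := hchordal (m + 1) hm C
  rcases lt_or_gt_of_ne (α := Fin (m + 1)) hij with hlt | hlt
  · exact key i j hlt h1 h2 h
  · exact key j i hlt h2 h1 h.symm

theorem nonempty_orientation (G : Graph α β) : Nonempty G.Orientation := by
  choose t h hl using fun e : G.edgeSet => exists_isLink_of_mem_edgeSet e.2
  exact ⟨⟨t, h, hl⟩⟩

/-! ### Nowhere-zero flows from short circuits -/

namespace Orientation

open Classical in
/-- The net inflow at `v` as a single sum over all edges. -/
theorem inflow_sub_outflow [Fintype G.edgeSet] (D : G.Orientation) {p : ℕ}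
    (φ : G.edgeSet → ZMod p) (v : α) :
    (∑ᶠ e ∈ {e | D.head e = v}, φ e) - (∑ᶠ e ∈ {e | D.tail e = v}, φ e) =
      ∑ e, φ e * ((if D.head e = v then 1 else 0) - (if D.tail e = v then 1 else 0)) := by
  rw [finsum_mem_def, finsum_mem_def, finsum_eq_sum_of_fintype, finsum_eq_sum_of_fintype,
    ← Finset.sum_sub_distrib]
  simp only [Set.indicator_apply, Set.mem_ofPred_eq, mul_sub, mul_ite, mul_one, mul_zero]

open Classical in
/-- The sign with which the `i`-th edge of `C` is traversed. -/
noncomputable def circuitSign (D : G.Orientation) (p : ℕ) {n : ℕ} [NeZero n] (C : G.Circuit n)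
    (i : ZMod n) : ZMod p :=
  if D.tail (C.edge i) = C.vert i then 1 else -1

theorem circuitSign_mul_self (D : G.Orientation) (p : ℕ) {n : ℕ} [NeZero n] (C : G.Circuit n)
    (i : ZMod n) : D.circuitSign p C i * D.circuitSign p C i = 1 := by
  unfold circuitSign
  split_ifs <;> simp

open Classical in
/-- The flow sending `a` around the circuit `C`. -/
noncomputable def circuitFlow (D : G.Orientation) {p n : ℕ} [NeZero n] (C : G.Circuit n)
    (a : ZMod p) (e : G.edgeSet) : ZMod p :=
  ∑ i, if C.edge i = e then D.circuitSign p C i * a else 0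

theorem circuitFlow_edge (D : G.Orientation) {p n : ℕ} [NeZero n] (C : G.Circuit n)
    (a : ZMod p) (i : ZMod n) : D.circuitFlow C a (C.edge i) = D.circuitSign p C i * a := by
  simp [circuitFlow, C.edge_injective.eq_iff]

theorem circuitFlow_eq_zero (D : G.Orientation) {p n : ℕ} [NeZero n] (C : G.Circuit n)
    (a : ZMod p) {e : G.edgeSet} (he : ∀ i, C.edge i ≠ e) : D.circuitFlow C a e = 0 := by
  simp [circuitFlow, he]

theorem isFlow_circuitFlow [Finite G.edgeSet] (D : G.Orientation) {p n : ℕ} [NeZero n]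
    (C : G.Circuit n) (a : ZMod p) : D.IsFlow (D.circuitFlow C a) := by
  classical
  have := Fintype.ofFinite G.edgeSet
  intro v _
  rw [inflow_sub_outflow]
  simp only [circuitFlow, Finset.sum_mul, ite_mul, zero_mul]
  rw [Finset.sum_comm]
  simp only [Finset.sum_ite_eq, Finset.mem_univ, if_true]
  -- The sign cancels the orientation, leaving differences that telescope around the circuit.
  have hterm : ∀ i, D.circuitSign p C i * a *
      ((if D.head (C.edge i) = v then 1 else 0) - (if D.tail (C.edge i) = v then 1 else 0)) =
      a * ((if C.vert (i + 1) = v then 1 else 0) - (if C.vert i = v then 1 else 0)) := fun i => by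
    have hends := (D.isLink (C.edge i)).eq_and_eq_or_eq_and_eq (C.isLink i)
    unfold circuitSign
    by_cases ht : D.tail (C.edge i) = C.vert i
    · have hh : D.head (C.edge i) = C.vert (i + 1) := by
        rcases hends with ⟨-, h⟩ | ⟨h1, h2⟩
        · exact h
        · rw [h2, ← ht, h1]
      rw [if_pos ht, ht, hh, one_mul]
    · obtain ⟨h1, h2⟩ := hends.resolve_left (fun h => ht h.1)
      rw [if_neg ht, h1, h2]
      ring
  have hshift : ∑ i, (if C.vert (i + 1) = v then (1 : ZMod p) else 0) =
      ∑ i, if C.vert i = v then 1 else 0 :=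
    Fintype.sum_equiv (Equiv.addRight 1) _ _ fun _ => rfl
  rw [Finset.sum_congr rfl fun i _ => hterm i, ← Finset.mul_sum, Finset.sum_sub_distrib, hshift,
    sub_self, mul_zero]

theorem IsFlow.add [Finite G.edgeSet] {D : G.Orientation} {p : ℕ} {φ ψ : G.edgeSet → ZMod p}
    (hφ : D.IsFlow φ) (hψ : D.IsFlow ψ) : D.IsFlow (φ + ψ) := by
  classical
  have := Fintype.ofFinite G.edgeSet
  intro v hv
  have h1 := hφ v hv
  have h2 := hψ v hv
  rw [inflow_sub_outflow] at h1 h2 ⊢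
  simp only [Pi.add_apply, add_mul, Finset.sum_add_distrib, h1, h2, add_zero]

/-- A flow can be changed along a circuit of length less than `p` to be nonzero on it. -/
theorem exists_circuitFlow_ne_zero (D : G.Orientation) {p n : ℕ} [NeZero p] [NeZero n]
    (hn : n < p) (C : G.Circuit n) (φ : G.edgeSet → ZMod p) :
    ∃ a : ZMod p, ∀ i, (φ + D.circuitFlow C a) (C.edge i) ≠ 0 := by
  classical
  -- The `i`-th edge excludes only the `a` solving `φ + sign * a = 0`.
  let bad : Finset (ZMod p) :=
    Finset.univ.image fun i : ZMod n => -(D.circuitSign p C i * φ (C.edge i))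
  have hcard : bad.card < (Finset.univ : Finset (ZMod p)).card := by
    refine lt_of_le_of_lt Finset.card_image_le ?_
    simpa [ZMod.card] using hn
  obtain ⟨a, -, ha⟩ := Finset.exists_mem_notMem_of_card_lt_card hcard
  refine ⟨a, fun i h => ha (Finset.mem_image.2 ⟨i, Finset.mem_univ i, ?_⟩)⟩
  rw [Pi.add_apply, circuitFlow_edge] at h
  linear_combination (-D.circuitSign p C i) * h + a * D.circuitSign_mul_self p C i

/-- If every edge lies in a circuit of length less than `p`, then for each orientation there is
a nowhere-zero `p`-flow. -/
theorem exists_isFlow_ne_zero [Finite G.edgeSet] (D : G.Orientation) {p : ℕ} [NeZero p]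
    (hcirc : ∀ e : G.edgeSet,
      ∃ (n : ℕ) (_ : NeZero n) (C : G.Circuit n), n < p ∧ ∃ i, C.edge i = e) :
    ∃ φ : G.edgeSet → ZMod p, D.IsFlow φ ∧ ∀ e, φ e ≠ 0 := by
  classical
  have := Fintype.ofFinite G.edgeSet
  suffices h : ∀ S : Finset G.edgeSet,
      ∃ φ : G.edgeSet → ZMod p, D.IsFlow φ ∧ ∀ e ∈ S, φ e ≠ 0 by
    obtain ⟨φ, h1, h2⟩ := h Finset.univ
    exact ⟨φ, h1, fun e => h2 e (Finset.mem_univ e)⟩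
  intro S
  induction S using Finset.induction_on with
  | empty => exact ⟨0, fun v _ => by simp, by simp⟩
  | insert e S _ ih =>
    obtain ⟨φ, hφ, hS⟩ := ih
    obtain ⟨n, _, C, hn, i, rfl⟩ := hcirc e
    obtain ⟨a, ha⟩ := D.exists_circuitFlow_ne_zero hn C φ
    refine ⟨_, hφ.add (D.isFlow_circuitFlow C a), fun f hf => ?_⟩
    by_cases hfC : ∃ j, C.edge j = f
    · obtain ⟨j, rfl⟩ := hfC
      exact ha j
    · rw [Pi.add_apply, D.circuitFlow_eq_zero C a (not_exists.1 hfC), add_zero]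
      rcases Finset.mem_insert.1 hf with rfl | hf
      · exact absurd ⟨i, rfl⟩ hfC
      · exact hS f hf

/-! ### Orientations and conformal dual flows -/

/-- Reorient the edges of `C` outside `F` along `C`. -/
theorem exists_reorient (D : G.Orientation) (F : Set G.edgeSet) {n : ℕ} [NeZero n]
    (C : G.Circuit n) :
    ∃ D' : G.Orientation, (∀ e ∈ F, D'.tail e = D.tail e) ∧
      ∀ i, C.edge i ∉ F → D'.tail (C.edge i) = C.vert i := by
  have h : ∀ e : G.edgeSet, ∃ x y, G.IsLink e x y ∧ (e ∈ F → x = D.tail e) ∧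
      ∀ i, C.edge i = e → e ∉ F → x = C.vert i := fun e => by
    by_cases he : (∃ i, C.edge i = e) ∧ e ∉ F
    · obtain ⟨⟨i, rfl⟩, hF⟩ := he
      exact ⟨_, _, C.isLink i, fun h => absurd h hF,
        fun j hj _ => by rw [C.edge_injective hj]⟩
    · exact ⟨_, _, D.isLink e, fun _ => rfl, fun i hi hF => absurd ⟨⟨i, hi⟩, hF⟩ he⟩
  choose t h hl h1 h2 using h
  exact ⟨⟨t, h, hl⟩, h1, fun i => h2 _ i rfl⟩

end Orientation

/-- Fewer than `p` elements of `{0, -1} ⊆ ℤ/p` with sum zero all vanish. -/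
theorem _root_.ZMod.eq_zero_of_sum_eq_zero {ι : Type*} [Fintype ι] {p : ℕ}
    (hcard : Fintype.card ι < p) {f : ι → ZMod p} (hf : ∀ i, f i = 0 ∨ f i = -1)
    (hsum : ∑ i, f i = 0) (i : ι) : f i = 0 := by
  classical
  -- The sum is minus the number of nonzero terms, a number below `p`.
  have hf' : ∀ i, f i = -(if f i ≠ 0 then 1 else 0) := fun i => by
    by_cases h : f i = 0
    · simp [h]
    · rw [if_pos h]
      exact (hf i).resolve_left h
  rw [Finset.sum_congr rfl fun i _ => hf' i, Finset.sum_neg_distrib, neg_eq_zero,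
    Finset.sum_boole, ZMod.natCast_eq_zero_iff] at hsum
  have hlt : (Finset.univ.filter fun i => f i ≠ 0).card < p :=
    lt_of_le_of_lt (Finset.card_filter_le _ _) hcard
  have h0 := Nat.eq_zero_of_dvd_of_lt hsum hlt
  rw [Finset.card_eq_zero, Finset.filter_eq_empty_iff] at h0
  simpa using h0 (Finset.mem_univ i)

/-- If every edge lies in a circuit of length less than `p`, then some orientation has no nonzero
`0`-conformal dual `p`-flow. -/
theorem exists_orientation_conformal_eq_zero [Finite G.edgeSet] {p : ℕ}
    (hcirc : ∀ e : G.edgeSet,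
      ∃ (n : ℕ) (_ : NeZero n) (C : G.Circuit n), n < p ∧ ∃ i, C.edge i = e) :
    ∃ D : G.Orientation, ∀ φ : G.edgeSet → ZMod p,
      D.IsDualFlow φ → IsConformal 0 φ → φ = 0 := by
  classical
  have := Fintype.ofFinite G.edgeSet
  -- Quantifying over all `D'` that agree with `D` on `F` lets the vanishing on `F` survive later
  -- reorientations of other edges.
  suffices h : ∀ S : Finset G.edgeSet, ∃ (D : G.Orientation) (F : Set G.edgeSet), ↑S ⊆ F ∧
      ∀ D' : G.Orientation, (∀ e ∈ F, D'.tail e = D.tail e) →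
        ∀ φ : G.edgeSet → ZMod p, D'.IsDualFlow φ → IsConformal 0 φ → ∀ e ∈ F, φ e = 0 by
    obtain ⟨D, F, hF, h⟩ := h Finset.univ
    exact ⟨D, fun φ h1 h2 => funext fun e =>
      h D (fun _ _ => rfl) φ h1 h2 e (hF (Finset.mem_univ e))⟩
  intro S
  induction S using Finset.induction_on with
  | empty =>
    obtain ⟨D⟩ := G.nonempty_orientation
    exact ⟨D, ∅, by simp, by simp⟩
  | insert e S _ ih =>
    obtain ⟨D, F, hSF, hD⟩ := ih
    obtain ⟨n, _, C, hn, i, rfl⟩ := hcirc e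
    obtain ⟨D₁, hF, hC⟩ := D.exists_reorient F C
    refine ⟨D₁, F ∪ Set.range C.edge, ?_, fun D' hD' φ hφ hconf => ?_⟩
    · rw [Finset.coe_insert, Set.insert_subset_iff]
      exact ⟨Or.inr ⟨i, rfl⟩, hSF.trans Set.subset_union_left⟩
    · have hF0 := hD D' (fun f hf => (hD' f (Or.inl hf)).trans (hF f hf)) φ hφ hconf
      -- An edge traversed backwards must lie in `F`, where `φ` vanishes, so its sign is immaterial.
      have hsum : ∑ j, φ (C.edge j) = 0 := by
        rw [← hφ n C]
        refine Finset.sum_congr rfl fun j _ => ?_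
        split_ifs with ht
        · rfl
        · have hj : C.edge j ∈ F := by
            by_contra hj
            exact ht ((hD' _ (Or.inr ⟨j, rfl⟩)).trans (hC j hj))
          rw [hF0 _ hj, neg_zero]
      have hC0 := ZMod.eq_zero_of_sum_eq_zero (by rwa [ZMod.card]) (fun j => hconf (C.edge j)) hsum
      rintro f (hf | ⟨j, rfl⟩)
      · exact hF0 f hf
      · exact hC0 j

end Graph

theorem mainTheorem5 {α β : Type*} (G : Graph α β)
    (hV : G.vertexSet.Finite) (hE : G.edgeSet.Finite)
    (hbridge : G.Bridgeless) (hchordal : G.IsChordal) :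
    G.IsFlowing 4 ∧
      ∃ D : G.Orientation, ∀ φ : G.edgeSet → ZMod 4,
        (D.IsDualFlow φ ∧ Graph.IsConformal 0 φ) ↔ φ = 0 := by
  have : Finite G.edgeSet := hE
  have hcirc : ∀ e : G.edgeSet,
      ∃ (n : ℕ) (_ : NeZero n) (C : G.Circuit n), n < 4 ∧ ∃ i, C.edge i = e := fun e => by
    obtain ⟨n, hn, C, hn3, he⟩ := Graph.exists_short_circuit hbridge hchordal e
    exact ⟨n, hn, C, by omega, he⟩
  obtain ⟨D₀⟩ := G.nonempty_orientation
  obtain ⟨D, hD⟩ := Graph.exists_orientation_conformal_eq_zero hcirc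
  refine ⟨⟨D₀, D₀.exists_isFlow_ne_zero hcirc⟩, D, fun φ => ⟨fun h => hD φ h.1 h.2, ?_⟩⟩
  rintro rfl
  exact ⟨fun n _ C => by simp [Graph.Orientation.circuitSum], fun e => Or.inl rfl⟩
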